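/- **Setting.** Consider the nominal system $\dot x=f(x)+g(x)u$ with $x\in\mathbb R^n$, $u\in\mathbb R^p$, where $f:\mathbb R^n\to\mathbb R^n$ and $g:\mathbb R^n\to\mathbb R^{n\times p}$ are locally Lipschitz and $f(0)=0$. Let $Q,R$ be symmetric positive definite and $l(x,u)=x^\top Qx+u^\top Ru$. Let $V^*$ be a continuously differentiable positive definite solution on $\mathbb R^n$ of the Hamilton–Jacobi–Bellman equation $\inf_{u\in\mathbb R^p}\{\nabla V^*(x)^\top(f(x)+g(x)u)+l(x,u)\}=0$, and suppose that $k^*(x)=-\tfrac12R^{-1}g(x)^\top\nabla V^*(x)$ is locally Lipschitz. Let $h:\mathbb R^n\to\mathbb R$ be the constraint function, with safe set $\mathscr C=\{h\ge 0\}$, let $m\ge1$, $\psi_0=h$ and $\psi_i=L_f\psi_{i-1}+\alpha_i(\psi_{i-1})$ for $1\le i\le m-1$, where each $\alpha_i:\mathbb R\to\mathbb R$ is $C^1$, strictly increasing, with $\alpha_i(0)=0$. Assume that $\psi_0,\dots,\psi_{m-1}$ are $C^1$ and $L_g\psi_i=0$ on $\mathscr C$ for $0\le i\le m-2$ (so that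 $\psi_1,\dots,\psi_{m-1}$ do not depend on the input). Put $\mathscr C_i=\{\psi_{i-1}>0\}$ and $\bar{\mathscr C}=\bigcap_{i=1}^m\mathscr C_i$. Assume $h(0)>0$ and $0<\underline g\le\|g(x)\|\le\bar g$ (Frobenius norm) for $x\in\mathscr C_m$. Let $\mathcal B:\mathscr C_m\to[0,\infty)$ be $C^1$ with $\mathcal B(0)=0$ and $\mathcal B(x)\to\infty$ as $x$ tends within $\mathscr C_m$ to any point of $\{\psi_{m-1}=0\}$. For $W>0$ let $\mathscr B=\{x\in\mathscr C_m:\|\nabla\mathcal B(x)\|^2\le W\}$. Put $a=\sqrt{R^{-1}}g^\top\nabla V^*$ and $b=\sqrt{R^{-1}}g^\top\nabla\mathcal B$. Let $\rho=\langle a,b\rangle/(\|a\|\|b\|)$ (with $\rho=0$ where $a=0$ or $b=0$), $L_g^-\mathcal B=\rho\,\frac{\|b\|}{\|a\|}\,g^\top\nabla V^*$ (zero where $a=0$), and $L_g^+\mathcal B=g^\top\nabla\mathcal B-L_g^-\mathcal B$. With $\mu\in[0,1]$, $Y>0$, $\bar K_s>0$, apply $u=k^*(x)+u^s$, where $$u^s=-K_sR^{-1}\big((1-\mu)L_g^-\mathcal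 B+L_g^+\mathcal B\big),\qquad \dot K_s=\operatorname{Proj}_{[0,\bar K_s]}\{-YK_s^2+\gamma e^{-h(x)}l(x,k^*(x))\},$$ where the projection sets the rate to zero whenever it would drive $K_s$ out of $[0,\bar K_s]$. Solutions of the closed loop with state $(x,K_s)\in\bar{\mathscr C}\times[0,\bar K_s]$ are understood in the sense of Carathéodory. **Theorem.** Suppose that one of the following conditions holds, where $\underline\sigma(R)$ is the smallest eigenvalue of $R$: * (C1) $0<\gamma<1$ and $\rho(x)\ge0$ for all $x\in\mathscr B$; * (C2) $0<\gamma<1$, $0\le\mu<1$ and $Y>\dfrac{(1-\mu)^2}{1-\gamma}\,\dfrac{W\bar g^2}{\underline\sigma(R)}$. Then the origin $(x,K_s)=(0,0)$ is an asymptotically stable equilibrium of the closed-loop system. Moreover, every closed-loop trajectory that is defined for all $t\ge0$, starts at any $x(0)\in\bar{\mathscr C}$ and $K_s(0)\in[0,\bar K_s]$, and satisfies $x(t)\in\mathscr B$ for all $t\ge0$, converges to the origin: $x(t)\to0$ and $K_s(t)\to0$ as $t\to\infty$. -/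

import Mathlib

open Filter Topology MeasureTheory Set
open scoped Matrix

noncomputable section

namespace AdaptiveSafeguard

/-- The Frobenius norm of a real matrix. -/
def frobNorm {n p : ℕ} (M : Matrix (Fin n) (Fin p) ℝ) : ℝ :=
  Real.sqrt (∑ i, ∑ j, M i j ^ 2)

/-- The smallest eigenvalue of a symmetric real matrix. -/
def minEigenvalue {p : ℕ} (M : Matrix (Fin p) (Fin p) ℝ) : ℝ :=
  sInf (spectrum ℝ M)

/-- An extended class `K` function that is continuously differentiable. -/
def IsSmoothExtendedClassK (a : ℝ → ℝ) : Prop :=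
  StrictMono a ∧ a 0 = 0 ∧ ContDiff ℝ 1 a

/-- `z` solves `ż = F z` on `[0, T]` in the sense of Carathéodory (`z` is absolutely continuous and
the equation holds for almost every time), in the equivalent integral form. Such solutions are
needed because the projected adaptive law has a discontinuous right-hand side. -/
def IsSolutionOn {X : Type*} [NormedAddCommGroup X] [NormedSpace ℝ X]
    (F : X → X) (z : ℝ → X) (T : ℝ) : Prop :=
  IntervalIntegrable (fun s => F (z s)) volume 0 T ∧
    ∀ t ∈ Icc 0 T, z t = z 0 + ∫ s in (0 : ℝ)..t, F (z s)

/-- `z` solves `ż = F z` on `[0, ∞)`. -/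
def IsGlobalSolution {X : Type*} [NormedAddCommGroup X] [NormedSpace ℝ X]
    (F : X → X) (z : ℝ → X) : Prop :=
  ∀ T : ℝ, 0 ≤ T → IsSolutionOn F z T

/-- The origin is an asymptotically stable equilibrium of `ż = F z` on the state space `D`:
it is an equilibrium, it is Lyapunov stable (for solutions on any time interval, so that a solution
is not assumed in advance to be defined for all times), and it is locally attractive. -/
def OriginAsymptoticallyStable {X : Type*} [NormedAddCommGroup X] [NormedSpace ℝ X]
    (F : X → X) (D : Set X) : Prop :=
  (0 ∈ D ∧ F 0 = 0) ∧
  (∀ ε > 0, ∃ δ > 0, ∀ (T : ℝ) (z : ℝ → X), IsSolutionOn F z T → z 0 ∈ D → ‖z 0‖ < δ →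
    ∀ t ∈ Icc 0 T, ‖z t‖ < ε) ∧
  (∃ δ > 0, ∀ z : ℝ → X, IsGlobalSolution F z → z 0 ∈ D → ‖z 0‖ < δ →
    Tendsto z atTop (𝓝 0))

/-- Projection of the rate `r` of a scalar parameter with current value `K` onto the interval
`[0, Kmax]`: the rate is kept unless it would drive the parameter out of the interval. -/
def projRate (Kmax K r : ℝ) : ℝ :=
  if (Kmax ≤ K ∧ 0 < r) ∨ (K ≤ 0 ∧ r < 0) then 0 else r

/-- The data of the control problem (no properties are imposed here). -/
structure ControlData (n p : ℕ) where
  /-- drift dynamics -/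
  f : EuclideanSpace ℝ (Fin n) → EuclideanSpace ℝ (Fin n)
  /-- control dynamics -/
  g : EuclideanSpace ℝ (Fin n) → Matrix (Fin n) (Fin p) ℝ
  /-- state weight -/
  Q : Matrix (Fin n) (Fin n) ℝ
  /-- input weight -/
  R : Matrix (Fin p) (Fin p) ℝ
  /-- the candidate solution `V*` of the HJB equation -/
  V : EuclideanSpace ℝ (Fin n) → ℝ
  /-- the constraint function; the safe set is `h ≥ 0` -/
  h : EuclideanSpace ℝ (Fin n) → ℝ
  /-- the relative degree -/
  m : ℕ
  /-- the functions `α₁, α₂, …, α_{m-1}` -/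
  α : ℕ → ℝ → ℝ
  /-- the energy function `𝓑`; only its values where `ψ_{m-1} > 0` matter -/
  energy : EuclideanSpace ℝ (Fin n) → ℝ
  /-- gradient manipulation parameter -/
  μ : ℝ
  /-- gain of the increasing term of the adaptive law -/
  γ : ℝ
  /-- gain of the decreasing term of the adaptive law -/
  Y : ℝ
  /-- upper bound enforced by the projection -/
  Kmax : ℝ

namespace ControlData

variable {n p : ℕ} (S : ControlData n p)

/-- `f x + g x u`, the right-hand side of the nominal system. -/
def nominal (x : EuclideanSpace ℝ (Fin n)) (u : Fin p → ℝ) : EuclideanSpace ℝ (Fin n) :=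
  S.f x + WithLp.toLp 2 (S.g x *ᵥ u)

/-- The running cost `l(x, u) = xᵀ Q x + uᵀ R u`. -/
def stageCost (x : EuclideanSpace ℝ (Fin n)) (u : Fin p → ℝ) : ℝ :=
  x.ofLp ⬝ᵥ (S.Q *ᵥ x.ofLp) + u ⬝ᵥ (S.R *ᵥ u)

/-- The Hamiltonian `H(x, q, u) = qᵀ (f x + g x u) + l(x, u)`. -/
def hamiltonian (x q : EuclideanSpace ℝ (Fin n)) (u : Fin p → ℝ) : ℝ :=
  inner ℝ q (S.nominal x u) + S.stageCost x u

/-- `V` is a continuously differentiable positive definite solution on `ℝⁿ` of the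
Hamilton–Jacobi–Bellman equation `inf_u H(x, ∇V(x), u) = 0`. -/
def IsHJBSolution : Prop :=
  ContDiff ℝ 1 S.V ∧ S.V 0 = 0 ∧ (∀ x, x ≠ 0 → 0 < S.V x) ∧
    ∀ x, IsGLB (range fun u => S.hamiltonian x (gradient S.V x) u) 0

/-- `L_g φ (x)` as a column vector, i.e. `g(x)ᵀ ∇φ(x)`. -/
def lieG (φ : EuclideanSpace ℝ (Fin n) → ℝ) (x : EuclideanSpace ℝ (Fin n)) : Fin p → ℝ :=
  (S.g x)ᵀ *ᵥ (gradient φ x).ofLp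

/-- The optimal policy `k*(x) = -½ R⁻¹ g(x)ᵀ ∇V(x)`. -/
def kStar (x : EuclideanSpace ℝ (Fin n)) : Fin p → ℝ :=
  (-(1 / 2) : ℝ) • (S.R⁻¹ *ᵥ S.lieG S.V x)

/-- `ψ₀ = h`, `ψ_i = L_f ψ_{i-1} + α_i(ψ_{i-1})`. -/
def psi : ℕ → EuclideanSpace ℝ (Fin n) → ℝ
  | 0 => S.h
  | i + 1 => fun x => inner ℝ (gradient (psi i) x) (S.f x) + S.α (i + 1) (psi i x)

/-- The set `𝒞_m = {ψ_{m-1} > 0}`, on which the energy function lives. -/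
def lastSet : Set (EuclideanSpace ℝ (Fin n)) :=
  {x | 0 < S.psi (S.m - 1) x}

/-- `𝒞₁ ∩ ⋯ ∩ 𝒞_m`, i.e. `ψ₀, …, ψ_{m-1} > 0`. -/
def safeCore : Set (EuclideanSpace ℝ (Fin n)) :=
  {x | ∀ i < S.m, 0 < S.psi i x}

/-- The energy function: continuously differentiable and nonnegative on `𝒞_m`, zero at the origin,
and tending to infinity at the set `ψ_{m-1} = 0`. -/
def IsEnergyFunction : Prop :=
  ContDiffOn ℝ 1 S.energy S.lastSet ∧ (∀ x ∈ S.lastSet, 0 ≤ S.energy x) ∧ S.energy 0 = 0 ∧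
    ∀ w, S.psi (S.m - 1) w = 0 → Tendsto S.energy (𝓝[S.lastSet] w) atTop

/-- The admissible safety risk set `{‖∇𝓑(x)‖² ≤ W}` (in the domain `𝒞_m` of `𝓑`). -/
def riskSet (W : ℝ) : Set (EuclideanSpace ℝ (Fin n)) :=
  {x | x ∈ S.lastSet ∧ ‖gradient S.energy x‖ ^ 2 ≤ W}

/-- `⟨√(R⁻¹) a, √(R⁻¹) b⟩`, which equals `aᵀ R⁻¹ b`. -/
def wInner (a b : Fin p → ℝ) : ℝ :=
  a ⬝ᵥ (S.R⁻¹ *ᵥ b)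

/-- `‖√(R⁻¹) a‖`. -/
def wNorm (a : Fin p → ℝ) : ℝ :=
  Real.sqrt (S.wInner a a)

/-- The gradient similarity `ρ(x)`, the cosine of the angle between `√(R⁻¹) gᵀ ∇V` and
`√(R⁻¹) L_g 𝓑`; it is `0` where one of the two vectors vanishes. -/
def rho (x : EuclideanSpace ℝ (Fin n)) : ℝ :=
  S.wInner (S.lieG S.V x) (S.lieG S.energy x) /
    (S.wNorm (S.lieG S.V x) * S.wNorm (S.lieG S.energy x))

/-- `L_g⁻ 𝓑`, the part of `L_g 𝓑` that is parallel to `gᵀ ∇V` in the `R⁻¹` inner product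
(zero where `gᵀ ∇V` vanishes). -/
def lieGMinus (x : EuclideanSpace ℝ (Fin n)) : Fin p → ℝ :=
  (S.rho x * (S.wNorm (S.lieG S.energy x) / S.wNorm (S.lieG S.V x))) • S.lieG S.V x

/-- `L_g⁺ 𝓑`, the orthogonal part. -/
def lieGPlus (x : EuclideanSpace ℝ (Fin n)) : Fin p → ℝ :=
  S.lieG S.energy x - S.lieGMinus x

/-- The safeguarding policy `u^s = -K R⁻¹ ((1 - μ) L_g⁻ 𝓑 + L_g⁺ 𝓑)`. -/
def uSafe (x : EuclideanSpace ℝ (Fin n)) (K : ℝ) : Fin p → ℝ :=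
  (-K) • (S.R⁻¹ *ᵥ ((1 - S.μ) • S.lieGMinus x + S.lieGPlus x))

/-- The adaptive law `K̇ = Proj {-Y K² + γ e^{-h(x)} l(x, k*(x))}`. -/
def gainRate (x : EuclideanSpace ℝ (Fin n)) (K : ℝ) : ℝ :=
  projRate S.Kmax K (-S.Y * K ^ 2 + S.γ * Real.exp (-S.h x) * S.stageCost x (S.kStar x))

/-- The closed loop in the state `(x, K)`: the nominal system under `u = k*(x) + u^s(x, K)`,
together with the adaptive law. -/
def closedLoop (z : EuclideanSpace ℝ (Fin n) × ℝ) : EuclideanSpace ℝ (Fin n) × ℝ :=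
  (S.nominal z.1 (S.kStar z.1 + S.uSafe z.1 z.2), S.gainRate z.1 z.2)

/-- The state space of the closed loop: safe states and gains in `[0, Kmax]`. -/
def stateSpace : Set (EuclideanSpace ℝ (Fin n) × ℝ) :=
  S.safeCore ×ˢ Icc 0 S.Kmax

/-- Condition (C1). -/
def CondC1 (W : ℝ) : Prop :=
  (0 < S.γ ∧ S.γ < 1) ∧ ∀ x ∈ S.riskSet W, 0 ≤ S.rho x

/-- Condition (C2). -/
def CondC2 (W gHi : ℝ) : Prop :=
  (0 < S.γ ∧ S.γ < 1) ∧ (0 ≤ S.μ ∧ S.μ < 1) ∧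
    (1 - S.μ) ^ 2 / (1 - S.γ) * (W * gHi ^ 2 / minEigenvalue S.R) < S.Y

end ControlData

end AdaptiveSafeguard

end

/-! The Lyapunov function is `E(x, K) = V(x) + K`, positive definite on `K ≥ 0`. Since `k*` attains
the infimum in the HJB equation, the derivative of `V` along the closed loop is `-l(x, k*) + L_gV ·
u^s`. As `L_g⁻𝓑` is the `R⁻¹`-orthogonal projection of `L_g𝓑` onto the line of `L_gV`, the last term
equals `-K (1 - μ) ⟨a, b⟩`. Where `h ≥ 0`, the adaptive law adds at most `-Y K² + γ l`, so `(1 - γ)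
l` and `Y K²` remain to absorb the cross term: under (C1) it is nonpositive, under (C2) Young's
inequality applies. Hence `E` decays at rate `c (‖x‖² + K²)` on the risk set where `h ≥ 0`
(`exists_decay_rate`), which is a neighbourhood of the origin because `𝓑` has a minimum there.

Stability is the classical sphere argument, valid from any starting time
(`exists_stability_radius`). Convergence needs neither properness of `V` nor an invariance
principle: staying at distance `δ` from the origin would make `E` negative, so the trajectory comes
arbitrarily close, and stability from that time on traps it (`tendsto_zero_of_forall_mem`). For the
final claim, `h > 0` along the trajectory follows from the cascade of the `ψ_i` (`mem_safeCore`).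
The closed loop is discontinuous, so every differential inequality is used in integrated form
(`IsSolutionOn.integral_fderiv`). -/

namespace AdaptiveSafeguard

/-! ### Calculus along Carathéodory solutions -/

section CaratheodorySolutions

variable {X : Type*} [NormedAddCommGroup X] [NormedSpace ℝ X] {F : X → X} {z : ℝ → X} {T : ℝ}

theorem absolutelyContinuousOnInterval_of_dist_le {Y Z : Type*} [PseudoMetricSpace Y]
    [PseudoMetricSpace Z] {f : ℝ → Y} {N : ℝ → Z} {a b C : ℝ}
    (hN : AbsolutelyContinuousOnInterval N a b)
    (h : ∀ s ∈ uIcc a b, ∀ t ∈ uIcc a b, dist (f s) (f t) ≤ C * dist (N s) (N t)) :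
    AbsolutelyContinuousOnInterval f a b := by
  have hCN := Tendsto.const_mul C hN
  rw [mul_zero] at hCN
  refine tendsto_of_tendsto_of_tendsto_of_le_of_le' tendsto_const_nhds hCN
    (Eventually.of_forall fun E => Finset.sum_nonneg fun _ _ => dist_nonneg) ?_
  filter_upwards [mem_inf_of_right (mem_principal_self _)] with E hE
  rw [Finset.mul_sum]
  exact Finset.sum_le_sum fun i hi => h _ (hE.1 i hi).1 _ (hE.1 i hi).2

theorem IsSolutionOn.continuousOn (hz : IsSolutionOn F z T) (hT : 0 ≤ T) :
    ContinuousOn z (Icc 0 T) := by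
  have h1 : ContinuousOn (fun t => z 0 + ∫ s in (0 : ℝ)..t, F (z s)) (Icc 0 T) := by
    have := intervalIntegral.continuousOn_primitive_interval (μ := volume)
      (f := fun s => F (z s)) (a := 0) (b := T)
      (by
        rw [uIcc_of_le hT, integrableOn_Icc_iff_integrableOn_Ioc]
        exact hz.1.1)
    rw [uIcc_of_le hT] at this
    exact continuousOn_const.add this
  exact h1.congr hz.2

/-- The chain rule along Carathéodory solutions, in integrated form. -/
theorem IsSolutionOn.integral_fderiv [CompleteSpace X] (hz : IsSolutionOn F z T)
    {φ : X → ℝ} (hφ : ContDiff ℝ 1 φ) {s t : ℝ} (hs : 0 ≤ s) (hst : s ≤ t) (ht : t ≤ T) :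
    IntervalIntegrable (fun τ => fderiv ℝ φ (z τ) (F (z τ))) volume s t ∧
      ∫ τ in s..t, fderiv ℝ φ (z τ) (F (z τ)) = φ (z t) - φ (z s) := by
  have hT : 0 ≤ T := hs.trans (hst.trans ht)
  -- `z` is arbitrary outside `[0, T]`; the primitive `w` agrees with it there and is differentiable
  -- almost everywhere on the interval.
  set w : ℝ → X := fun t => z 0 + ∫ s in (0 : ℝ)..t, F (z s) with hw
  have hzw : ∀ t ∈ Icc 0 T, z t = w t := hz.2
  set N : ℝ → ℝ := fun t => ∫ s in (0 : ℝ)..t, ‖F (z s)‖ with hN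
  have hNac : AbsolutelyContinuousOnInterval N 0 T :=
    hz.1.norm.absolutelyContinuousOnInterval_intervalIntegral (by simp)
  have hcomp : IsCompact (w '' Icc 0 T) :=
    isCompact_Icc.image_of_continuousOn ((hz.continuousOn hT).congr fun t ht => (hzw t ht).symm)
  obtain ⟨C, hC⟩ := LocallyLipschitzOn.exists_lipschitzOnWith_of_compact hcomp
    (hφ.locallyLipschitz.locallyLipschitzOn)
  have hint : ∀ a ∈ Icc 0 T, ∀ b ∈ Icc 0 T, IntervalIntegrable (fun s => F (z s)) volume a b :=
    fun a ha b hb => hz.1.mono_set (by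
      rw [uIcc_of_le hT]; exact (uIcc_subset_Icc ha hb))
  have hwN : ∀ a ∈ Icc 0 T, ∀ b ∈ Icc 0 T, dist (w a) (w b) ≤ dist (N a) (N b) := by
    intro a ha b hb
    have h0 : (0 : ℝ) ∈ Icc 0 T := ⟨le_rfl, hT⟩
    rw [dist_eq_norm, Real.dist_eq]
    simp only [hw, hN, add_sub_add_left_eq_sub]
    rw [intervalIntegral.integral_interval_sub_left (hint _ h0 _ ha) (hint _ h0 _ hb),
      intervalIntegral.integral_interval_sub_left (hint _ h0 _ ha).norm (hint _ h0 _ hb).norm]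
    exact intervalIntegral.norm_integral_le_abs_integral_norm
  -- `φ` is Lipschitz on the compact trajectory, so increments of `φ ∘ w` are controlled by those of
  -- `N`, the primitive of `‖F‖`.
  have hac : AbsolutelyContinuousOnInterval (φ ∘ w) 0 T := by
    refine absolutelyContinuousOnInterval_of_dist_le (C := C) hNac ?_
    rw [uIcc_of_le hT]
    intro a ha b hb
    exact (hC.dist_le_mul _ (mem_image_of_mem _ ha) _ (mem_image_of_mem _ hb)).trans
      (mul_le_mul_of_nonneg_left (hwN a ha b hb) C.2)
  have hac' : AbsolutelyContinuousOnInterval (φ ∘ w) s t := by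
    refine hac.mono ?_
    rw [uIcc_of_le hT, uIcc_of_le hst]
    exact Icc_subset_Icc hs ht
  have hae : ∀ᵐ τ, τ ∈ uIoc s t → deriv (φ ∘ w) τ = fderiv ℝ φ (z τ) (F (z τ)) := by
    filter_upwards [hz.1.ae_hasDerivAt_integral] with τ hτ hmem
    rw [uIoc_of_le hst] at hmem
    have hmT : τ ∈ Icc 0 T := ⟨hs.trans hmem.1.le, hmem.2.trans ht⟩
    have h1 := (hτ (by rwa [uIcc_of_le hT]) 0 (by simp)).const_add (z 0)
    have h2 : HasDerivAt w (F (z τ)) τ := h1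
    have h3 : HasFDerivAt φ (fderiv ℝ φ (z τ)) (w τ) := by
      rw [hzw τ hmT]
      exact (hφ.differentiable one_ne_zero _).hasFDerivAt
    exact (h3.comp_hasDerivAt τ h2).deriv
  have hae' : ∀ᵐ τ ∂(volume.restrict (uIoc s t)),
      deriv (φ ∘ w) τ = fderiv ℝ φ (z τ) (F (z τ)) :=
    (ae_restrict_iff' measurableSet_uIoc).2 hae
  refine ⟨(intervalIntegrable_congr_ae hae').1 hac'.intervalIntegrable_deriv, ?_⟩
  rw [← intervalIntegral.integral_congr_ae hae, hac'.integral_deriv_eq_sub,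
    hzw t ⟨hs.trans hst, ht⟩, hzw s ⟨hs, hst.trans ht⟩]
  rfl

theorem IsSolutionOn.sub_le_integral [CompleteSpace X] (hz : IsSolutionOn F z T)
    {φ : X → ℝ} (hφ : ContDiff ℝ 1 φ) {s t : ℝ} (hs : 0 ≤ s) (hst : s ≤ t) (ht : t ≤ T)
    {c : ℝ → ℝ} (hc : IntervalIntegrable c volume s t)
    (h : ∀ τ ∈ Ioo s t, fderiv ℝ φ (z τ) (F (z τ)) ≤ c τ) :
    φ (z t) - φ (z s) ≤ ∫ τ in s..t, c τ := by
  obtain ⟨h1, h2⟩ := hz.integral_fderiv hφ hs hst ht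
  rw [← h2]
  exact intervalIntegral.integral_mono_on_of_le_Ioo hst h1 hc h

theorem IsSolutionOn.integral_le_sub [CompleteSpace X] (hz : IsSolutionOn F z T)
    {φ : X → ℝ} (hφ : ContDiff ℝ 1 φ) {s t : ℝ} (hs : 0 ≤ s) (hst : s ≤ t) (ht : t ≤ T)
    {c : ℝ → ℝ} (hc : IntervalIntegrable c volume s t)
    (h : ∀ τ ∈ Ioo s t, c τ ≤ fderiv ℝ φ (z τ) (F (z τ))) :
    ∫ τ in s..t, c τ ≤ φ (z t) - φ (z s) := by
  obtain ⟨h1, h2⟩ := hz.integral_fderiv hφ hs hst ht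
  rw [← h2]
  exact intervalIntegral.integral_mono_on_of_le_Ioo hst hc h1 h

theorem IsSolutionOn.nonneg_of_fderiv_nonneg [CompleteSpace X] (hz : IsSolutionOn F z T)
    {φ : X → ℝ} (hφ : ContDiff ℝ 1 φ) (h0 : 0 ≤ φ (z 0))
    (h : ∀ x, φ x < 0 → 0 ≤ fderiv ℝ φ x (F x)) {t : ℝ} (ht : t ∈ Icc 0 T) : 0 ≤ φ (z t) := by
  by_contra! hneg
  have hcont : ContinuousOn (fun τ => φ (z τ)) (Icc 0 t) :=
    hφ.continuous.comp_continuousOn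
      ((hz.continuousOn (ht.1.trans ht.2)).mono (Icc_subset_Icc_right ht.2))
  have hcpt : IsCompact (Icc 0 t ∩ (fun τ => φ (z τ)) ⁻¹' Ici 0) :=
    isCompact_Icc.of_isClosed_subset (hcont.preimage_isClosed_of_isClosed isClosed_Icc isClosed_Ici)
      inter_subset_left
  -- After the last time `s` with `φ ≥ 0`, the hypothesis applies throughout and forbids any
  -- decrease.
  obtain ⟨s, ⟨hs, hs0⟩, hmax⟩ := hcpt.exists_isGreatest ⟨0, ⟨le_rfl, ht.1⟩, h0⟩
  have key := hz.integral_le_sub hφ hs.1 hs.2 ht.2 (c := fun _ => 0)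
    intervalIntegrable_const (fun τ hτ => h _ (by
      by_contra! hτ0
      exact absurd (hmax ⟨⟨hs.1.trans hτ.1.le, hτ.2.le⟩, hτ0⟩) (not_le.2 hτ.1)))
  have hs0' : 0 ≤ φ (z s) := hs0
  simp only [intervalIntegral.integral_zero] at key
  linarith

/-- A quantity that decays at most exponentially does not reach zero in finite time. -/
theorem IsSolutionOn.pos_of_neg_mul_le_fderiv [CompleteSpace X] (hz : IsSolutionOn F z T)
    {φ : X → ℝ} (hφ : ContDiff ℝ 1 φ) {L : ℝ} {τ : ℝ} (hτ : τ ∈ Icc 0 T)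
    (h0 : 0 < φ (z 0)) (hpos : ∀ s ∈ Ico 0 τ, 0 < φ (z s))
    (h : ∀ s ∈ Ico 0 τ, -(L * φ (z s)) ≤ fderiv ℝ φ (z s) (F (z s))) : 0 < φ (z τ) := by
  by_contra! hneg
  have hτ0 : 0 < τ := by
    rcases hτ.1.eq_or_lt with h' | h'
    · rw [← h'] at hneg; linarith
    · exact h'
  -- On a window of length at most `1 / (2M)` ending at `τ`, the decay from the maximum of `φ` costs
  -- at most half of that maximum.
  set M := max L 1
  have hM : 0 < M := lt_max_of_lt_right one_pos
  set s := max 0 (τ - 1 / (2 * M))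
  have hs0 : 0 ≤ s := le_max_left _ _
  have hsτ : s < τ := max_lt hτ0 (by have : 0 < 1 / (2 * M) := by positivity
                                     linarith)
  have hcont : ContinuousOn (fun r => φ (z r)) (Icc s τ) :=
    hφ.continuous.comp_continuousOn
      ((hz.continuousOn (hτ.1.trans hτ.2)).mono (Icc_subset_Icc hs0 hτ.2))
  obtain ⟨r, hr, hrmax⟩ := isCompact_Icc.exists_isMaxOn (nonempty_Icc.2 hsτ.le) hcont
  have hmax : ∀ q ∈ Icc s τ, φ (z q) ≤ φ (z r) := fun q hq => hrmax hq
  have hrpos : 0 < φ (z r) := (hpos s ⟨hs0, hsτ⟩).trans_le (hmax s ⟨le_rfl, hsτ.le⟩)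
  have key := hz.integral_le_sub hφ (hs0.trans hr.1) hr.2 hτ.2 (c := fun _ => -(M * φ (z r)))
    intervalIntegrable_const (fun q hq => by
      have hq' : q ∈ Ico 0 τ := ⟨(hs0.trans hr.1).trans hq.1.le, hq.2⟩
      refine le_trans ?_ (h q hq')
      have h1 : L * φ (z q) ≤ M * φ (z q) :=
        mul_le_mul_of_nonneg_right (le_max_left _ _) (hpos q hq').le
      have h2 : M * φ (z q) ≤ M * φ (z r) :=
        mul_le_mul_of_nonneg_left (hmax q ⟨hr.1.trans hq.1.le, hq.2.le⟩) hM.le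
      linarith)
  rw [intervalIntegral.integral_const, smul_eq_mul] at key
  have h3 : τ - r ≤ 1 / (2 * M) := by
    have := hr.1
    have := le_max_right 0 (τ - 1 / (2 * M))
    linarith
  have h4 : (τ - r) * (M * φ (z r)) ≤ 1 / (2 * M) * (M * φ (z r)) :=
    mul_le_mul_of_nonneg_right h3 (by positivity)
  have h5 : 1 / (2 * M) * (M * φ (z r)) = φ (z r) / 2 := by field_simp
  linarith

end CaratheodorySolutions

end AdaptiveSafeguard

namespace AdaptiveSafeguard

/-! ### Quadratic forms and the smallest eigenvalue -/

section QuadraticForms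

variable {n p : ℕ}

theorem minEigenvalue_le_of_mem_spectrum {M : Matrix (Fin p) (Fin p) ℝ} {r : ℝ}
    (hr : r ∈ spectrum ℝ M) : minEigenvalue M ≤ r :=
  csInf_le M.finite_spectrum.bddBelow hr

/-- In dimension zero the spectrum is empty and its `sInf` is `0`, hence the `Nonempty` assumption.
-/
theorem minEigenvalue_pos [Nonempty (Fin p)] {M : Matrix (Fin p) (Fin p) ℝ} (hM : M.PosDef) :
    0 < minEigenvalue M := by
  have hne : (spectrum ℝ M).Nonempty :=
    ⟨_, hM.isHermitian.eigenvalues_mem_spectrum_real (Classical.arbitrary _)⟩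
  have hmem : minEigenvalue M ∈ spectrum ℝ M := hne.csInf_mem M.finite_spectrum
  rw [hM.isHermitian.spectrum_real_eq_range_eigenvalues] at hmem
  obtain ⟨i, hi⟩ := hmem
  rw [← hi]
  exact hM.eigenvalues_pos i

theorem minEigenvalue_mul_le_dotProduct {M : Matrix (Fin p) (Fin p) ℝ} (hM : M.PosDef)
    (v : Fin p → ℝ) : minEigenvalue M * (v ⬝ᵥ v) ≤ v ⬝ᵥ (M *ᵥ v) := by
  have hps : (M - algebraMap ℝ (Matrix (Fin p) (Fin p) ℝ) (minEigenvalue M)).PosSemidef := by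
    rw [Matrix.posSemidef_iff_isHermitian_and_spectrum_nonneg]
    refine ⟨hM.isHermitian.sub ?_, fun r hr => ?_⟩
    · rw [Matrix.algebraMap_eq_diagonal]
      exact Matrix.isHermitian_diagonal _
    · have h1 : r + minEigenvalue M ∈ spectrum ℝ M := by
        have := (spectrum.add_mem_add_iff (r := r) (s := minEigenvalue M)).2 hr
        simpa [add_comm] using this
      have := minEigenvalue_le_of_mem_spectrum h1
      simp only [mem_ofPred_eq]
      linarith
  have h := hps.dotProduct_mulVec_nonneg v
  simp only [star_trivial, Matrix.sub_mulVec, dotProduct_sub, Matrix.algebraMap_eq_diagonal,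
    Pi.algebraMap_def, Algebra.algebraMap_self, RingHom.id_apply] at h
  have h2 : Matrix.diagonal (fun _ : Fin p => minEigenvalue M) *ᵥ v = minEigenvalue M • v := by
    ext i; simp [Matrix.mulVec_diagonal]
  rw [h2, dotProduct_smul, smul_eq_mul] at h
  linarith

theorem dotProduct_sq_le (u v : Fin p → ℝ) : (u ⬝ᵥ v) ^ 2 ≤ (u ⬝ᵥ u) * (v ⬝ᵥ v) := by
  have := Finset.sum_mul_sq_le_sq_mul_sq Finset.univ u v
  simpa [dotProduct, sq] using this

/-- With `y = M⁻¹ b` and `σ` the smallest eigenvalue, `σ ‖y‖² ≤ b · y` and Cauchy–Schwarz give `σ (b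
· y)² ≤ ‖b‖² (b · y)`. Arguing by contradiction makes `b · y` positive. -/
theorem dotProduct_inv_mulVec_le [Nonempty (Fin p)] {M : Matrix (Fin p) (Fin p) ℝ}
    (hM : M.PosDef) (b : Fin p → ℝ) : b ⬝ᵥ (M⁻¹ *ᵥ b) ≤ (b ⬝ᵥ b) / minEigenvalue M := by
  have hσ := minEigenvalue_pos hM
  set y := M⁻¹ *ᵥ b with hy
  have hMy : M *ᵥ y = b := by
    rw [hy, Matrix.mulVec_mulVec, Matrix.mul_nonsing_inv _ ((Matrix.isUnit_iff_isUnit_det _).1 hM.isUnit),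
      Matrix.one_mulVec]
  have h1 := minEigenvalue_mul_le_dotProduct hM y
  rw [hMy, dotProduct_comm y b] at h1
  have h2 := dotProduct_sq_le b y
  have hyy : 0 ≤ y ⬝ᵥ y := dotProduct_self_star_nonneg y
  have hbb : 0 ≤ b ⬝ᵥ b := dotProduct_self_star_nonneg b
  rw [le_div_iff₀ hσ]
  by_contra! h3
  have hby : 0 < b ⬝ᵥ y := by
    by_contra! h4
    nlinarith
  have h5 : (b ⬝ᵥ b) * (y ⬝ᵥ y) ≤ (b ⬝ᵥ y * minEigenvalue M) * (y ⬝ᵥ y) :=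
    mul_le_mul_of_nonneg_right h3.le hyy
  have h6 : (b ⬝ᵥ y) * (minEigenvalue M * (y ⬝ᵥ y)) ≤ (b ⬝ᵥ y) * (b ⬝ᵥ y) :=
    mul_le_mul_of_nonneg_left h1 hby.le
  have hypos : 0 < y ⬝ᵥ y := by
    rcases hyy.eq_or_lt with h | h
    · rw [← h] at h2; nlinarith
    · exact h
  nlinarith [mul_lt_mul_of_pos_right h3 hypos]

theorem dotProduct_transpose_mulVec_self_le (M : Matrix (Fin n) (Fin p) ℝ) (v : Fin n → ℝ) :
    (Mᵀ *ᵥ v) ⬝ᵥ (Mᵀ *ᵥ v) ≤ frobNorm M ^ 2 * (v ⬝ᵥ v) := by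
  rw [frobNorm, Real.sq_sqrt (by positivity), Finset.sum_comm, Finset.sum_mul]
  simp only [dotProduct, Matrix.mulVec, Matrix.transpose_apply]
  refine Finset.sum_le_sum fun j _ => ?_
  have := Finset.sum_mul_sq_le_sq_mul_sq Finset.univ (fun i => M i j) v
  simpa [sq] using this

theorem dotProduct_mulVec_add_self {M : Matrix (Fin p) (Fin p) ℝ} (hM : M.IsHermitian)
    (u v : Fin p → ℝ) : (u + v) ⬝ᵥ (M *ᵥ (u + v)) =
      u ⬝ᵥ (M *ᵥ u) + 2 * (v ⬝ᵥ (M *ᵥ u)) + v ⬝ᵥ (M *ᵥ v) := by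
  have hsymm : u ⬝ᵥ (M *ᵥ v) = v ⬝ᵥ (M *ᵥ u) := by
    rw [Matrix.dotProduct_mulVec, ← Matrix.mulVec_transpose, dotProduct_comm]
    congr 2
  rw [Matrix.mulVec_add, dotProduct_add, add_dotProduct, add_dotProduct, hsymm]
  ring

end QuadraticForms

end AdaptiveSafeguard

namespace AdaptiveSafeguard

/-- Projection at the upper end lowers the rate; only at `K = 0` could it raise a negative one,
which `hr` excludes. -/
theorem projRate_le {Kmax K r : ℝ} (hK : 0 ≤ K) (hr : K = 0 → 0 ≤ r) : projRate Kmax K r ≤ r := by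
  unfold projRate
  split_ifs with h
  · rcases h with h | h
    · exact h.2.le
    · exact hr (le_antisymm h.1 hK)
  · exact le_rfl

theorem projRate_nonneg_of_neg {Kmax K r : ℝ} (hK : K < 0) : 0 ≤ projRate Kmax K r := by
  unfold projRate
  split_ifs with h
  · exact le_rfl
  · by_contra! hr
    exact h (Or.inr ⟨hK.le, hr⟩)

theorem gradient_eq_zero_of_isLocalMin {E : Type*} [NormedAddCommGroup E] [InnerProductSpace ℝ E]
    [CompleteSpace E] {φ : E → ℝ} {x : E} (h : IsLocalMin φ x) : gradient φ x = 0 := by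
  rw [gradient, h.fderiv_eq_zero, map_zero]

namespace ControlData

variable {n p : ℕ} {S : ControlData n p}

/-! ### The `R⁻¹` inner product and the splitting of `L_g𝓑` -/

section RInner

theorem wInner_self_nonneg (hR : S.R.PosDef) (a : Fin p → ℝ) : 0 ≤ S.wInner a a :=
  hR.inv.posSemidef.dotProduct_mulVec_nonneg a

theorem wNorm_sq (hR : S.R.PosDef) (a : Fin p → ℝ) : S.wNorm a ^ 2 = S.wInner a a :=
  Real.sq_sqrt (wInner_self_nonneg hR a)

theorem wNorm_nonneg (a : Fin p → ℝ) : 0 ≤ S.wNorm a := Real.sqrt_nonneg _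

theorem wNorm_eq_zero (hR : S.R.PosDef) {a : Fin p → ℝ} (h : S.wNorm a = 0) : a = 0 := by
  by_contra ha
  have h1 : 0 < S.wInner a a := hR.inv.dotProduct_mulVec_pos ha
  rw [← wNorm_sq hR, h] at h1
  norm_num at h1

theorem wInner_comm (hR : S.R.PosDef) (a b : Fin p → ℝ) : S.wInner a b = S.wInner b a := by
  have h : (S.R⁻¹)ᵀ = S.R⁻¹ := hR.inv.isHermitian
  rw [wInner, Matrix.dotProduct_mulVec, ← Matrix.mulVec_transpose, dotProduct_comm, h, wInner]

theorem wInner_add_right (a b c : Fin p → ℝ) :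
    S.wInner a (b + c) = S.wInner a b + S.wInner a c := by
  simp [wInner, Matrix.mulVec_add, dotProduct_add]

theorem wInner_smul_right (r : ℝ) (a b : Fin p → ℝ) : S.wInner a (r • b) = r * S.wInner a b := by
  simp [wInner, Matrix.mulVec_smul, dotProduct_smul]

theorem abs_wInner_le (hR : S.R.PosDef) (a b : Fin p → ℝ) :
    |S.wInner a b| ≤ S.wNorm a * S.wNorm b := by
  rcases (wNorm_nonneg (S := S) b).eq_or_lt with hb | hb
  · rw [wNorm_eq_zero hR hb.symm]
    simp [wInner, wNorm]
  -- Cauchy–Schwarz: the residual of projecting `a` onto `b` has nonnegative square.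
  have hquad := wInner_self_nonneg hR (a + (-(S.wInner a b / S.wInner b b)) • b)
  have hbb : 0 < S.wInner b b := by rw [← wNorm_sq hR]; positivity
  have hexp := dotProduct_mulVec_add_self hR.inv.isHermitian a
    ((-(S.wInner a b / S.wInner b b)) • b)
  rw [wInner, hexp, Matrix.mulVec_smul, dotProduct_smul, smul_dotProduct, smul_dotProduct] at hquad
  change 0 ≤ S.wInner a a + 2 * (-(S.wInner a b / S.wInner b b) * S.wInner b a) +
    -(S.wInner a b / S.wInner b b) * (-(S.wInner a b / S.wInner b b) * S.wInner b b) at hquad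
  rw [wInner_comm hR b a] at hquad
  have h2 : S.wInner a a + 2 * (-(S.wInner a b / S.wInner b b) * S.wInner a b) +
      -(S.wInner a b / S.wInner b b) * (-(S.wInner a b / S.wInner b b) * S.wInner b b) =
      (S.wInner a a * S.wInner b b - S.wInner a b ^ 2) / S.wInner b b := by
    field_simp; ring
  rw [h2, le_div_iff₀ hbb, zero_mul] at hquad
  rw [← wNorm_sq hR, ← wNorm_sq hR] at hquad
  refine abs_le_of_sq_le_sq ?_ (mul_nonneg (wNorm_nonneg a) hb.le)
  rw [mul_pow]
  linarith

/-- Where a norm vanishes, division by zero sets `ρ = 0`, and Cauchy–Schwarz makes the inner product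
vanish too. -/
theorem rho_mul_wNorm_mul_wNorm (hR : S.R.PosDef) (x : EuclideanSpace ℝ (Fin n)) :
    S.rho x * (S.wNorm (S.lieG S.V x) * S.wNorm (S.lieG S.energy x)) =
      S.wInner (S.lieG S.V x) (S.lieG S.energy x) := by
  rw [rho]
  by_cases h : S.wNorm (S.lieG S.V x) * S.wNorm (S.lieG S.energy x) = 0
  · have := abs_wInner_le hR (S.lieG S.V x) (S.lieG S.energy x)
    rw [h] at this ⊢
    rw [mul_zero, abs_eq_zero.1 (le_antisymm this (abs_nonneg _))]
  · exact div_mul_cancel₀ _ h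

theorem wInner_lieGMinus (hR : S.R.PosDef) (x : EuclideanSpace ℝ (Fin n)) :
    S.wInner (S.lieG S.V x) (S.lieGMinus x) = S.wInner (S.lieG S.V x) (S.lieG S.energy x) := by
  rw [lieGMinus, wInner_smul_right, ← wNorm_sq hR, ← rho_mul_wNorm_mul_wNorm hR]
  by_cases h : S.wNorm (S.lieG S.V x) = 0
  · simp [h]
  · field_simp

theorem lieG_dotProduct_uSafe (hR : S.R.PosDef) (x : EuclideanSpace ℝ (Fin n)) (K : ℝ) :
    S.lieG S.V x ⬝ᵥ S.uSafe x K =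
      -K * ((1 - S.μ) * S.wInner (S.lieG S.V x) (S.lieG S.energy x)) := by
  have h1 : (1 - S.μ) • S.lieGMinus x + S.lieGPlus x =
      (-S.μ) • S.lieGMinus x + S.lieG S.energy x := by
    rw [lieGPlus]; module
  rw [uSafe, dotProduct_smul, smul_eq_mul, h1]
  change -K * S.wInner _ _ = _
  rw [wInner_add_right, wInner_smul_right, wInner_lieGMinus hR]
  ring

/-- Source of the constant `W ḡ² / σ(R)` in (C2). -/
theorem wInner_lieG_energy_le [Nonempty (Fin p)] (hR : S.R.PosDef) {W gHi : ℝ}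
    {x : EuclideanSpace ℝ (Fin n)} (hx : x ∈ S.riskSet W) (hg : frobNorm (S.g x) ≤ gHi) :
    S.wInner (S.lieG S.energy x) (S.lieG S.energy x) ≤ W * gHi ^ 2 / minEigenvalue S.R := by
  refine (dotProduct_inv_mulVec_le hR _).trans
    (div_le_div_of_nonneg_right ?_ (minEigenvalue_pos hR).le)
  refine (dotProduct_transpose_mulVec_self_le _ _).trans ?_
  have h1 : (gradient S.energy x).ofLp ⬝ᵥ (gradient S.energy x).ofLp =
      ‖gradient S.energy x‖ ^ 2 := by
    rw [EuclideanSpace.real_norm_sq_eq, dotProduct]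
    simp [sq]
  rw [h1, mul_comm]
  have hg0 : 0 ≤ frobNorm (S.g x) := Real.sqrt_nonneg _
  exact mul_le_mul hx.2 (pow_le_pow_left₀ hg0 hg 2) (by positivity) ((sq_nonneg _).trans hx.2)

end RInner

/-! ### The HJB equation and dissipation of `V + K` -/

section OptimalPolicy

theorem inner_gradient_nominal (φ : EuclideanSpace ℝ (Fin n) → ℝ) (x : EuclideanSpace ℝ (Fin n))
    (u : Fin p → ℝ) : inner ℝ (gradient φ x) (S.nominal x u) =
      inner ℝ (gradient φ x) (S.f x) + S.lieG φ x ⬝ᵥ u := by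
  rw [nominal, inner_add_right]
  congr 1
  rw [lieG, Matrix.mulVec_transpose, ← Matrix.dotProduct_mulVec, EuclideanSpace.inner_eq_star_dotProduct,
    dotProduct_comm]
  simp

theorem R_mulVec_kStar (hR : S.R.PosDef) (x : EuclideanSpace ℝ (Fin n)) :
    S.R *ᵥ S.kStar x = (-(1 / 2) : ℝ) • S.lieG S.V x := by
  rw [kStar, Matrix.mulVec_smul, Matrix.mulVec_mulVec,
    Matrix.mul_nonsing_inv _ ((Matrix.isUnit_iff_isUnit_det _).1 hR.isUnit), Matrix.one_mulVec]

/-- Completing the square: the terms linear in `u` cancel because `2 R k* = -L_gV`. -/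
theorem hamiltonian_eq_add (hR : S.R.PosDef) (x : EuclideanSpace ℝ (Fin n)) (u : Fin p → ℝ) :
    S.hamiltonian x (gradient S.V x) (S.kStar x + u) =
      S.hamiltonian x (gradient S.V x) (S.kStar x) + u ⬝ᵥ (S.R *ᵥ u) := by
  rw [hamiltonian, hamiltonian, inner_gradient_nominal, inner_gradient_nominal, stageCost,
    stageCost, dotProduct_mulVec_add_self hR.isHermitian, R_mulVec_kStar hR, dotProduct_smul,
    dotProduct_smul, dotProduct_add, dotProduct_comm u (S.lieG S.V x), smul_eq_mul, smul_eq_mul]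
  ring

/-- The optimal policy attains the infimum in the Hamilton–Jacobi–Bellman equation. -/
theorem IsHJBSolution.hamiltonian_kStar (hV : S.IsHJBSolution) (hR : S.R.PosDef)
    (x : EuclideanSpace ℝ (Fin n)) : S.hamiltonian x (gradient S.V x) (S.kStar x) = 0 := by
  refine le_antisymm ((hV.2.2.2 x).2 ?_) ((hV.2.2.2 x).1 ⟨S.kStar x, rfl⟩)
  rintro _ ⟨u, rfl⟩
  have h := hamiltonian_eq_add hR x (u - S.kStar x)
  rw [add_sub_cancel] at h
  have h1 : 0 ≤ (u - S.kStar x) ⬝ᵥ (S.R *ᵥ (u - S.kStar x)) :=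
    hR.posSemidef.dotProduct_mulVec_nonneg (u - S.kStar x)
  change _ ≤ S.hamiltonian x (gradient S.V x) u
  rw [h]
  linarith

theorem IsHJBSolution.inner_gradient_nominal_add (hV : S.IsHJBSolution) (hR : S.R.PosDef)
    (x : EuclideanSpace ℝ (Fin n)) (u : Fin p → ℝ) :
    inner ℝ (gradient S.V x) (S.nominal x (S.kStar x + u)) =
      -S.stageCost x (S.kStar x) + S.lieG S.V x ⬝ᵥ u := by
  have h := hV.hamiltonian_kStar hR x
  rw [hamiltonian, inner_gradient_nominal] at h
  rw [inner_gradient_nominal, dotProduct_add]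
  linarith

theorem stageCost_kStar (hR : S.R.PosDef) (x : EuclideanSpace ℝ (Fin n)) :
    S.stageCost x (S.kStar x) =
      x.ofLp ⬝ᵥ (S.Q *ᵥ x.ofLp) + S.wNorm (S.lieG S.V x) ^ 2 / 4 := by
  rw [stageCost, R_mulVec_kStar hR, dotProduct_smul, kStar, smul_dotProduct,
    dotProduct_comm (S.R⁻¹ *ᵥ _), wNorm_sq hR, wInner, smul_eq_mul, smul_eq_mul]
  ring

theorem stageCost_nonneg (hQ : S.Q.PosDef) (hR : S.R.PosDef) (x : EuclideanSpace ℝ (Fin n))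
    (u : Fin p → ℝ) : 0 ≤ S.stageCost x u :=
  add_nonneg (hQ.posSemidef.dotProduct_mulVec_nonneg x.ofLp) (hR.posSemidef.dotProduct_mulVec_nonneg u)

theorem minEigenvalue_mul_norm_sq_le (hQ : S.Q.PosDef) (x : EuclideanSpace ℝ (Fin n)) :
    minEigenvalue S.Q * ‖x‖ ^ 2 ≤ x.ofLp ⬝ᵥ (S.Q *ᵥ x.ofLp) := by
  have h := minEigenvalue_mul_le_dotProduct hQ x.ofLp
  rwa [show x.ofLp ⬝ᵥ x.ofLp = ‖x‖ ^ 2 by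
    rw [EuclideanSpace.real_norm_sq_eq, dotProduct]; simp [sq]] at h

theorem gainRate_le (hQ : S.Q.PosDef) (hR : S.R.PosDef) (hγ : 0 < S.γ)
    {x : EuclideanSpace ℝ (Fin n)} (hx : 0 ≤ S.h x) {K : ℝ} (hK : 0 ≤ K) :
    S.gainRate x K ≤ -S.Y * K ^ 2 + S.γ * S.stageCost x (S.kStar x) := by
  have hl := stageCost_nonneg hQ hR x (S.kStar x)
  refine (projRate_le hK ?_).trans ?_
  · rintro rfl
    have : 0 ≤ S.γ * Real.exp (-S.h x) * S.stageCost x (S.kStar x) := by positivity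
    linarith
  · have h1 : Real.exp (-S.h x) ≤ 1 := Real.exp_le_one_iff.2 (by linarith)
    have h2 : S.γ * Real.exp (-S.h x) ≤ S.γ := mul_le_of_le_one_right hγ.le h1
    have := mul_le_mul_of_nonneg_right h2 hl
    linarith

end OptimalPolicy

/-- The Lyapunov function `V(x) + K` decreases at a quadratic rate on the risk set. -/
theorem exists_decay_rate [Nonempty (Fin n)] [Nonempty (Fin p)] (hQ : S.Q.PosDef)
    (hR : S.R.PosDef) (hV : S.IsHJBSolution) {gHi W : ℝ}
    (hgHi : ∀ x ∈ S.lastSet, frobNorm (S.g x) ≤ gHi) (hμ : S.μ ≤ 1) (hY : 0 < S.Y)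
    (hC : S.CondC1 W ∨ S.CondC2 W gHi) :
    ∃ c > 0, ∀ x ∈ S.riskSet W, 0 ≤ S.h x → ∀ K, 0 ≤ K →
      inner ℝ (gradient S.V x) (S.nominal x (S.kStar x + S.uSafe x K)) + S.gainRate x K ≤
        -(c * (‖x‖ ^ 2 + K ^ 2)) := by
  have hq := minEigenvalue_pos hQ
  obtain ⟨hγ0, hγ1⟩ : 0 < S.γ ∧ S.γ < 1 := hC.elim (fun h => h.1) (fun h => h.1)
  -- Of the remaining `(1 - γ) l`, the `Q` part gives decay in `x` and the part `‖a‖² / 4` pays for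
  -- the cross term; `d` is what is left of `Y`.
  suffices H : ∃ d > 0, ∀ x ∈ S.riskSet W, ∀ K, 0 ≤ K →
      -K * ((1 - S.μ) * S.wInner (S.lieG S.V x) (S.lieG S.energy x)) ≤
        (1 - S.γ) * (S.wNorm (S.lieG S.V x) ^ 2 / 4) + (S.Y - d) * K ^ 2 by
    obtain ⟨d, hd, H⟩ := H
    refine ⟨min ((1 - S.γ) * minEigenvalue S.Q) d,
      lt_min (mul_pos (by linarith) hq) hd, fun x hx hh K hK => ?_⟩
    have h1 := H x hx K hK
    have h2 := gainRate_le hQ hR hγ0 hh hK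
    have h3 := mul_le_mul_of_nonneg_left (minEigenvalue_mul_norm_sq_le hQ x)
      (by linarith : 0 ≤ 1 - S.γ)
    rw [hV.inner_gradient_nominal_add hR, lieG_dotProduct_uSafe hR]
    rw [stageCost_kStar hR] at h2 ⊢
    have h4 := mul_le_mul_of_nonneg_right
      (min_le_left ((1 - S.γ) * minEigenvalue S.Q) d) (sq_nonneg ‖x‖)
    have h5 := mul_le_mul_of_nonneg_right
      (min_le_right ((1 - S.γ) * minEigenvalue S.Q) d) (sq_nonneg K)
    linarith
  rcases hC with hC | hC
  · refine ⟨S.Y, hY, fun x hx K hK => ?_⟩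
    have h1 : 0 ≤ S.wInner (S.lieG S.V x) (S.lieG S.energy x) := by
      rw [← rho_mul_wNorm_mul_wNorm hR]
      exact mul_nonneg (hC.2 x hx) (mul_nonneg (wNorm_nonneg _) (wNorm_nonneg _))
    have h2 : 0 ≤ K * ((1 - S.μ) * S.wInner (S.lieG S.V x) (S.lieG S.energy x)) :=
      mul_nonneg hK (mul_nonneg (by linarith) h1)
    have h3 : 0 ≤ (1 - S.γ) * (S.wNorm (S.lieG S.V x) ^ 2 / 4) :=
      mul_nonneg (by linarith) (by positivity)
    linarith
  · refine ⟨S.Y - (1 - S.μ) ^ 2 / (1 - S.γ) * (W * gHi ^ 2 / minEigenvalue S.R),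
      sub_pos.2 hC.2.2, fun x hx K hK => ?_⟩
    have hγ : 0 < 1 - S.γ := by linarith
    have hβ := wInner_lieG_energy_le hR hx (hgHi x hx.1)
    rw [← wNorm_sq hR] at hβ
    set A := S.wNorm (S.lieG S.V x)
    set B := S.wNorm (S.lieG S.energy x)
    have hab := neg_le_of_abs_le (abs_wInner_le hR (S.lieG S.V x) (S.lieG S.energy x))
    have h1 : -K * ((1 - S.μ) * S.wInner (S.lieG S.V x) (S.lieG S.energy x)) ≤
        K * (1 - S.μ) * (A * B) := by
      have := mul_le_mul_of_nonneg_left hab (mul_nonneg hK (by linarith : 0 ≤ 1 - S.μ))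
      linarith
    have h2 : K * (1 - S.μ) * (A * B) ≤
        (1 - S.γ) * (A ^ 2 / 4) + (1 - S.μ) ^ 2 / (1 - S.γ) * B ^ 2 * K ^ 2 := by
      -- Young's inequality, weighted so that the `A²` term uses exactly the available `(1 - γ) A² /
      -- 4`.
      have h3 : (1 - S.γ) * (A ^ 2 / 4) + (1 - S.μ) ^ 2 / (1 - S.γ) * B ^ 2 * K ^ 2 -
          K * (1 - S.μ) * (A * B) =
          (1 - S.γ) * (A / 2 - (1 - S.μ) / (1 - S.γ) * B * K) ^ 2 := by
        field_simp; ring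
      have h4 : 0 ≤ (1 - S.γ) * (A / 2 - (1 - S.μ) / (1 - S.γ) * B * K) ^ 2 := by positivity
      linarith
    have h5 : (1 - S.μ) ^ 2 / (1 - S.γ) * B ^ 2 * K ^ 2 ≤
        (1 - S.μ) ^ 2 / (1 - S.γ) * (W * gHi ^ 2 / minEigenvalue S.R) * K ^ 2 := by
      gcongr
    linarith

end ControlData

end AdaptiveSafeguard

namespace AdaptiveSafeguard

namespace ControlData

variable {n p : ℕ} {S : ControlData n p}

/-! ### The equilibrium and its neighbourhoods -/

section Geometry

theorem IsHJBSolution.gradient_zero (hV : S.IsHJBSolution) : gradient S.V 0 = 0 := by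
  refine gradient_eq_zero_of_isLocalMin (Eventually.of_forall fun x => ?_)
  rw [hV.2.1]
  by_cases hx : x = 0
  · rw [hx, hV.2.1]
  · exact (hV.2.2.1 x hx).le

theorem closedLoop_zero (hf0 : S.f 0 = 0) (hV : S.IsHJBSolution) : S.closedLoop 0 = 0 := by
  have hk : S.kStar 0 = 0 := by simp [kStar, lieG, hV.gradient_zero]
  simp [closedLoop, nominal, uSafe, gainRate, stageCost, projRate, hk, hf0, Prod.ext_iff]

theorem psi_zero_pos (hf0 : S.f 0 = 0)
    (hα : ∀ i, 1 ≤ i → i < S.m → IsSmoothExtendedClassK (S.α i)) (h0 : 0 < S.h 0) :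
    ∀ i < S.m, 0 < S.psi i 0
  | 0, _ => h0
  | i + 1, hi => by
    have h1 := psi_zero_pos hf0 hα h0 i (by omega)
    obtain ⟨hmono, hz, -⟩ := hα (i + 1) (by omega) hi
    simp only [psi, hf0, inner_zero_right, zero_add]
    rw [← hz]
    exact hmono h1

theorem isOpen_lastSet (hψ : ContDiff ℝ 1 (S.psi (S.m - 1))) : IsOpen S.lastSet :=
  isOpen_lt continuous_const hψ.continuous

/-- `𝓑 ≥ 0 = 𝓑(0)` on an open set, so `∇𝓑(0) = 0`, and `∇𝓑` is continuous there. -/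
theorem riskSet_mem_nhds_zero (hψ : ContDiff ℝ 1 (S.psi (S.m - 1))) (h0 : 0 ∈ S.lastSet)
    (hB : S.IsEnergyFunction) {W : ℝ} (hW : 0 < W) : S.riskSet W ∈ 𝓝 0 := by
  have ho := isOpen_lastSet hψ
  have hnhds : S.lastSet ∈ 𝓝 0 := ho.mem_nhds h0
  have hgrad : gradient S.energy 0 = 0 := by
    refine gradient_eq_zero_of_isLocalMin ?_
    filter_upwards [hnhds] with x hx
    rw [hB.2.2.1]
    exact hB.2.1 x hx
  have hcont : ContinuousAt (fun x => ‖gradient S.energy x‖ ^ 2) 0 := by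
    have h1 : ContinuousAt (fderiv ℝ S.energy) 0 :=
      (hB.1.continuousOn_fderiv_of_isOpen ho le_rfl).continuousAt hnhds
    have h2 : ContinuousAt (gradient S.energy) 0 :=
      (InnerProductSpace.toDual ℝ _).symm.continuous.continuousAt.comp h1
    exact h2.norm.pow 2
  have hlt : ∀ᶠ x in 𝓝 0, ‖gradient S.energy x‖ ^ 2 < W :=
    hcont.eventually_lt continuousAt_const (by simpa [hgrad] using hW)
  filter_upwards [hnhds, hlt] with x hx hx'
  exact ⟨hx, hx'.le⟩

end Geometry

/-! ### Safety, stability and convergence of trajectories -/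

section Trajectories

variable {z : ℝ → EuclideanSpace ℝ (Fin n) × ℝ} {T : ℝ}

theorem fderiv_comp_fst {φ : EuclideanSpace ℝ (Fin n) → ℝ} (hφ : ContDiff ℝ 1 φ)
    (x v : EuclideanSpace ℝ (Fin n) × ℝ) :
    fderiv ℝ (fun y : EuclideanSpace ℝ (Fin n) × ℝ => φ y.1) x v =
      inner ℝ (gradient φ x.1) v.1 := by
  have h1 : HasFDerivAt (fun y : EuclideanSpace ℝ (Fin n) × ℝ => φ y.1)
      ((fderiv ℝ φ x.1).comp (ContinuousLinearMap.fst ℝ _ ℝ)) x :=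
    ((hφ.differentiable one_ne_zero x.1).hasFDerivAt).comp x hasFDerivAt_fst
  rw [h1.fderiv, inner_gradient_left]
  rfl

theorem fderiv_comp_fst_add_snd {φ : EuclideanSpace ℝ (Fin n) → ℝ} (hφ : ContDiff ℝ 1 φ)
    (x v : EuclideanSpace ℝ (Fin n) × ℝ) :
    fderiv ℝ (fun y : EuclideanSpace ℝ (Fin n) × ℝ => φ y.1 + y.2) x v =
      inner ℝ (gradient φ x.1) v.1 + v.2 := by
  have h1 : HasFDerivAt (fun y : EuclideanSpace ℝ (Fin n) × ℝ => φ y.1 + y.2)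
      ((fderiv ℝ φ x.1).comp (ContinuousLinearMap.fst ℝ _ ℝ) +
        ContinuousLinearMap.snd ℝ _ ℝ) x :=
    (((hφ.differentiable one_ne_zero x.1).hasFDerivAt).comp x hasFDerivAt_fst).add hasFDerivAt_snd
  rw [h1.fderiv, inner_gradient_left]
  rfl

theorem gain_nonneg (hz : IsSolutionOn S.closedLoop z T) (h0 : 0 ≤ (z 0).2) {t : ℝ}
    (ht : t ∈ Icc 0 T) : 0 ≤ (z t).2 := by
  refine hz.nonneg_of_fderiv_nonneg (φ := fun y => y.2) contDiff_snd h0 (fun x hx => ?_) ht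
  have h1 : fderiv ℝ (fun y : EuclideanSpace ℝ (Fin n) × ℝ => y.2) x =
      ContinuousLinearMap.snd ℝ _ ℝ := fderiv_snd
  rw [h1]
  exact projRate_nonneg_of_neg hx

/-- Since `L_gψ_i = 0`, the derivative of `ψ_i` is `ψ_{i+1} - α_{i+1}(ψ_i) ≥ -L ψ_i`, where `L` is a
Lipschitz constant of `α_{i+1}` on the range of values met up to time `τ`. -/
theorem psi_pos_of_forall_lt (hz : IsSolutionOn S.closedLoop z T) {i : ℕ} (hi : i + 1 < S.m)
    (hα : IsSmoothExtendedClassK (S.α (i + 1))) (hψ : ContDiff ℝ 1 (S.psi i))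
    (hrel : ∀ x, 0 ≤ S.h x → S.lieG (S.psi i) x = 0) {τ : ℝ} (hτ : τ ∈ Icc 0 T)
    (h0 : 0 < S.psi i (z 0).1) (hpos : ∀ s ∈ Ico 0 τ, (z s).1 ∈ S.safeCore) :
    0 < S.psi i (z τ).1 := by
  have hφ : ContDiff ℝ 1 fun y : EuclideanSpace ℝ (Fin n) × ℝ => S.psi i y.1 :=
    hψ.comp contDiff_fst
  have hcont : ContinuousOn (fun s => S.psi i (z s).1) (Icc 0 τ) :=
    hφ.continuous.comp_continuousOn
      ((hz.continuousOn (hτ.1.trans hτ.2)).mono (Icc_subset_Icc_right hτ.2))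
  obtain ⟨M, hM⟩ := (isCompact_Icc.image_of_continuousOn hcont).bddAbove
  obtain ⟨L, hL⟩ := LocallyLipschitzOn.exists_lipschitzOnWith_of_compact
    (isCompact_Icc (a := (0 : ℝ)) (b := M)) hα.2.2.locallyLipschitz.locallyLipschitzOn
  refine hz.pos_of_neg_mul_le_fderiv hφ (L := L) hτ h0 (fun s hs => hpos s hs i (by omega))
    fun s hs => ?_
  have hs1 : 0 < S.psi i (z s).1 := hpos s hs i (by omega)
  have hs2 : 0 < S.psi (i + 1) (z s).1 := hpos s hs (i + 1) hi
  have hsh : 0 < S.h (z s).1 := hpos s hs 0 (by omega)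
  have hsM : S.psi i (z s).1 ≤ M := hM (mem_image_of_mem _ ⟨hs.1, hs.2.le⟩)
  have hαL : S.α (i + 1) (S.psi i (z s).1) ≤ L * S.psi i (z s).1 := by
    have h1 := hL.dist_le_mul _ ⟨hs1.le, hsM⟩ 0 ⟨le_rfl, hs1.le.trans hsM⟩
    rw [hα.2.1, Real.dist_eq, Real.dist_eq, sub_zero, sub_zero, abs_of_pos hs1] at h1
    exact (le_abs_self _).trans h1
  rw [fderiv_comp_fst hψ]
  change _ ≤ inner ℝ (gradient (S.psi i) (z s).1) (S.nominal (z s).1 _)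
  rw [inner_gradient_nominal, hrel _ hsh.le, zero_dotProduct, add_zero]
  simp only [psi] at hs2
  linarith

/-- The high-order constraint conditions keep the state safe as long as `ψ_{m-1}` is positive. -/
theorem mem_safeCore (hz : IsSolutionOn S.closedLoop z T)
    (hα : ∀ i, 1 ≤ i → i < S.m → IsSmoothExtendedClassK (S.α i))
    (hψ : ∀ i < S.m, ContDiff ℝ 1 (S.psi i))
    (hrel : ∀ i, i + 1 < S.m → ∀ x, 0 ≤ S.h x → S.lieG (S.psi i) x = 0)
    (h0 : (z 0).1 ∈ S.safeCore) (hlast : ∀ t ∈ Icc 0 T, (z t).1 ∈ S.lastSet) {t : ℝ}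
    (ht : t ∈ Icc 0 T) : (z t).1 ∈ S.safeCore := by
  by_contra hbad
  have hcz := hz.continuousOn (ht.1.trans ht.2)
  have hclosed : IsClosed (Icc 0 T ∩
      ⋃ i ∈ Finset.range S.m, Icc 0 T ∩ (fun s => S.psi i (z s).1) ⁻¹' Iic 0) := by
    refine isClosed_Icc.inter (isClosed_biUnion_finset fun i hi => ?_)
    exact ((hψ i (Finset.mem_range.1 hi)).continuous.comp_continuousOn
      (continuous_fst.comp_continuousOn hcz)).preimage_isClosed_of_isClosed isClosed_Icc
        isClosed_Iic
  have hmem : ∀ s, s ∈ Icc 0 T ∩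
      ⋃ i ∈ Finset.range S.m, Icc 0 T ∩ (fun s => S.psi i (z s).1) ⁻¹' Iic 0 ↔
        s ∈ Icc 0 T ∧ (z s).1 ∉ S.safeCore := by
    intro s
    simp only [mem_inter_iff, mem_iUnion, Finset.mem_range, mem_preimage, mem_Iic, safeCore,
      mem_ofPred_eq, not_forall, not_lt, exists_prop]
    constructor
    · rintro ⟨h1, i, hi, -, h2⟩
      exact ⟨h1, i, hi, h2⟩
    · rintro ⟨h1, i, hi, h2⟩
      exact ⟨h1, i, hi, h1, h2⟩
  -- At the first unsafe time `τ`, every `ψ_i` with `i < m - 1` is positive by the decay bound, and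
  -- `ψ_{m-1}` by assumption.
  obtain ⟨τ, hτ, hmin⟩ := (isCompact_Icc.of_isClosed_subset hclosed inter_subset_left).exists_isLeast
    ⟨t, (hmem t).2 ⟨ht, hbad⟩⟩
  rw [hmem] at hτ
  refine hτ.2 fun i hi => ?_
  by_cases hi' : i + 1 < S.m
  · refine psi_pos_of_forall_lt hz hi' (hα _ (by omega) hi') (hψ i hi) (hrel i hi') hτ.1
      (h0 i hi) fun s hs => ?_
    by_contra hs'
    exact absurd (hmin ((hmem s).2 ⟨⟨hs.1, hs.2.le.trans hτ.1.2⟩, hs'⟩)) (not_le.2 hs.2)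
  · have : i = S.m - 1 := by omega
    rw [this]
    exact hlast τ hτ.1

/-- Dissipation along trajectories in a set where `V(x) + K` decreases at a quadratic rate. -/
theorem lyapunov_sub_le (hV : ContDiff ℝ 1 S.V) {G : Set (EuclideanSpace ℝ (Fin n))} {c : ℝ}
    (hc : 0 ≤ c) (hdecay : ∀ x ∈ G, ∀ K, 0 ≤ K →
      inner ℝ (gradient S.V x) (S.nominal x (S.kStar x + S.uSafe x K)) + S.gainRate x K ≤
        -(c * (‖x‖ ^ 2 + K ^ 2)))
    (hz : IsSolutionOn S.closedLoop z T) (h0 : 0 ≤ (z 0).2) {s t d : ℝ} (hs : 0 ≤ s) (hst : s ≤ t)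
    (ht : t ≤ T) (hG : ∀ τ ∈ Ioo s t, (z τ).1 ∈ G) (hd0 : 0 ≤ d)
    (hd : ∀ τ ∈ Ioo s t, d ≤ ‖z τ‖) :
    (S.V (z t).1 + (z t).2) - (S.V (z s).1 + (z s).2) ≤ -(c * d ^ 2) * (t - s) := by
  have hφ : ContDiff ℝ 1 fun y : EuclideanSpace ℝ (Fin n) × ℝ => S.V y.1 + y.2 :=
    (hV.comp contDiff_fst).add contDiff_snd
  have key := hz.sub_le_integral hφ hs hst ht (c := fun _ => -(c * d ^ 2))
    intervalIntegrable_const fun τ hτ => by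
      rw [fderiv_comp_fst_add_snd hV]
      refine (hdecay _ (hG τ hτ) _ (gain_nonneg hz h0
        ⟨hs.trans hτ.1.le, hτ.2.le.trans ht⟩)).trans (neg_le_neg ?_)
      refine mul_le_mul_of_nonneg_left ?_ hc
      have h1 := pow_le_pow_left₀ hd0 (hd τ hτ) 2
      -- The product carries the sup norm, so one component alone already has norm at least `d`.
      rw [Prod.norm_def] at h1
      rcases max_choice ‖(z τ).1‖ ‖(z τ).2‖ with h | h <;> rw [h] at h1
      · nlinarith [sq_nonneg (z τ).2]
      · rw [Real.norm_eq_abs, sq_abs] at h1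
        nlinarith [sq_nonneg ‖(z τ).1‖]
  rw [intervalIntegral.integral_const, smul_eq_mul, mul_comm] at key
  exact key

theorem IsHJBSolution.lyapunov_nonneg (hV : S.IsHJBSolution) (x : EuclideanSpace ℝ (Fin n)) {K : ℝ}
    (hK : 0 ≤ K) : 0 ≤ S.V x + K := by
  by_cases hx : x = 0
  · rw [hx, hV.2.1]; linarith
  · linarith [hV.2.2.1 x hx]

/-- Lyapunov stability, started at an arbitrary time. -/
theorem exists_stability_radius (hV : S.IsHJBSolution) {G : Set (EuclideanSpace ℝ (Fin n))}
    (hG0 : G ∈ 𝓝 0) {c : ℝ} (hc : 0 ≤ c) (hdecay : ∀ x ∈ G, ∀ K, 0 ≤ K →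
      inner ℝ (gradient S.V x) (S.nominal x (S.kStar x + S.uSafe x K)) + S.gainRate x K ≤
        -(c * (‖x‖ ^ 2 + K ^ 2))) {ε : ℝ} (hε : 0 < ε) :
    ∃ δ > 0, ∀ (T : ℝ) (z : ℝ → EuclideanSpace ℝ (Fin n) × ℝ), IsSolutionOn S.closedLoop z T →
      0 ≤ (z 0).2 → ∀ s, 0 ≤ s → ‖z s‖ < δ → ∀ t ∈ Icc s T, ‖z t‖ < ε ∧ (z t).1 ∈ G := by
  obtain ⟨r₀, hr₀, hball⟩ := Metric.mem_nhds_iff.1 hG0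
  set r := min ε r₀ with hr
  have hrpos : 0 < r := lt_min hε hr₀
  have hEcont : Continuous fun y : EuclideanSpace ℝ (Fin n) × ℝ => S.V y.1 + y.2 :=
    (hV.1.continuous.comp continuous_fst).add continuous_snd
  -- `V + K` is positive away from the origin only on `K ≥ 0`, so the minimum is taken over that
  -- part of the sphere.
  obtain ⟨e, he, hsphere⟩ : ∃ e > 0, ∀ y : EuclideanSpace ℝ (Fin n) × ℝ, ‖y‖ = r → 0 ≤ y.2 →
      e ≤ S.V y.1 + y.2 := by
    have hcpt : IsCompact (Metric.sphere (0 : EuclideanSpace ℝ (Fin n) × ℝ) r ∩ {y | 0 ≤ y.2}) :=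
      (isCompact_sphere _ _).inter_right (isClosed_le continuous_const continuous_snd)
    have hne : (Metric.sphere (0 : EuclideanSpace ℝ (Fin n) × ℝ) r ∩ {y | 0 ≤ y.2}).Nonempty :=
      ⟨(0, r), by simp [Prod.norm_def, abs_of_pos hrpos, hrpos.le], hrpos.le⟩
    obtain ⟨y, ⟨hy1, hy2⟩, hmin⟩ := hcpt.exists_isMinOn hne hEcont.continuousOn
    refine ⟨S.V y.1 + y.2, ?_, fun w hw1 hw2 => hmin ⟨by simpa using hw1, hw2⟩⟩
    have hy2' : 0 ≤ y.2 := hy2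
    by_cases hx : y.1 = 0
    · rw [hx, hV.2.1, zero_add]
      refine hy2'.lt_of_ne fun h => hrpos.ne ?_
      have : y = 0 := Prod.ext hx h.symm
      rw [← (by simpa using hy1 : ‖y‖ = r), this, norm_zero]
    · linarith [hV.2.2.1 _ hx]
  obtain ⟨δ', hδ', hsmall⟩ : ∃ δ > 0, ∀ y : EuclideanSpace ℝ (Fin n) × ℝ, ‖y‖ < δ →
      S.V y.1 + y.2 < e := by
    have h1 : ∀ᶠ y in 𝓝 (0 : EuclideanSpace ℝ (Fin n) × ℝ), S.V y.1 + y.2 < e :=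
      hEcont.continuousAt.eventually_lt continuousAt_const (by simpa [hV.2.1] using he)
    obtain ⟨δ, hδ, h⟩ := Metric.eventually_nhds_iff.1 h1
    exact ⟨δ, hδ, fun y hy => h (by simpa using hy)⟩
  refine ⟨min δ' r, lt_min hδ' hrpos, fun T z hz h0 s hs hzs => ?_⟩
  have hin : ∀ t ∈ Icc s T, ‖z t‖ < r → ‖z t‖ < ε ∧ (z t).1 ∈ G := fun t _ h =>
    ⟨h.trans_le (min_le_left _ _), hball (by
      rw [mem_ball_zero_iff]
      exact ((norm_fst_le _).trans_lt h).trans_le (min_le_right _ _))⟩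
  suffices H : ∀ t ∈ Icc s T, ‖z t‖ < r from fun t ht => hin t ht (H t ht)
  intro t ht
  by_contra! hbad
  have hcz : ContinuousOn (fun τ => ‖z τ‖) (Icc s t) :=
    ((hz.continuousOn (hs.trans (ht.1.trans ht.2))).mono (Icc_subset_Icc hs ht.2)).norm
  have hcpt : IsCompact (Icc s t ∩ (fun τ => ‖z τ‖) ⁻¹' Ici r) :=
    isCompact_Icc.of_isClosed_subset (hcz.preimage_isClosed_of_isClosed isClosed_Icc isClosed_Ici)
      inter_subset_left
  obtain ⟨q, ⟨hq, hqr⟩, hmin⟩ := hcpt.exists_isLeast ⟨t, ⟨ht.1, le_rfl⟩, hbad⟩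
  have hlt : ∀ τ ∈ Ico s q, ‖z τ‖ < r := fun τ hτ => by
    by_contra! h
    exact absurd (hmin ⟨⟨hτ.1, hτ.2.le.trans hq.2⟩, h⟩) (not_le.2 hτ.2)
  obtain ⟨q', hq', hq'r⟩ := intermediate_value_Icc hq.1 (hcz.mono (Icc_subset_Icc_right hq.2))
    ⟨(hzs.trans_le (min_le_right _ _)).le, hqr⟩
  have hqq : q' = q := hq'.2.eq_of_not_lt fun h => (hlt q' ⟨hq'.1, h⟩).ne hq'r
  rw [hqq] at hq'r
  -- Up to the first hitting time `q` of the sphere the state lies in `G`; `d = 0` gives just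
  -- monotonicity of `V + K`, contradicting `E(z s) < e ≤ E(z q)`.
  have key := lyapunov_sub_le hV.1 hc hdecay hz h0 hs hq.1 (hq.2.trans ht.2)
    (fun τ hτ => (hin τ ⟨hτ.1.le, hτ.2.le.trans (hq.2.trans ht.2)⟩ (hlt τ ⟨hτ.1.le, hτ.2⟩)).2)
    le_rfl (fun τ _ => norm_nonneg _)
  have h1 := hsphere (z q) hq'r (gain_nonneg hz h0 ⟨hs.trans hq.1, hq.2.trans ht.2⟩)
  have h2 := hsmall (z s) (hzs.trans_le (min_le_left _ _))
  simp at key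
  linarith

/-- A trajectory that stays in the region of decrease converges, by stability and since it cannot
stay away from the origin. -/
theorem tendsto_zero_of_forall_mem (hV : S.IsHJBSolution) {G : Set (EuclideanSpace ℝ (Fin n))}
    (hG0 : G ∈ 𝓝 0) {c : ℝ} (hc : 0 < c) (hdecay : ∀ x ∈ G, ∀ K, 0 ≤ K →
      inner ℝ (gradient S.V x) (S.nominal x (S.kStar x + S.uSafe x K)) + S.gainRate x K ≤
        -(c * (‖x‖ ^ 2 + K ^ 2)))
    (hz : IsGlobalSolution S.closedLoop z) (h0 : 0 ≤ (z 0).2) (hG : ∀ t, 0 ≤ t → (z t).1 ∈ G) :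
    Tendsto z atTop (𝓝 0) := by
  rw [Metric.tendsto_atTop]
  intro ε hε
  obtain ⟨δ, hδ, hstab⟩ := exists_stability_radius hV hG0 hc.le hdecay hε
  obtain ⟨s, hs, hsδ⟩ : ∃ s, 0 ≤ s ∧ ‖z s‖ < δ := by
    by_contra! hfar
    set E₀ := S.V (z 0).1 + (z 0).2 with hE₀
    have hE₀nn : 0 ≤ E₀ := hV.lyapunov_nonneg _ h0
    -- By this time `V + K` would have dropped by `E₀ + 1`, below zero.
    set t := (E₀ + 1) / (c * δ ^ 2)
    have ht : 0 ≤ t := by positivity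
    have key := lyapunov_sub_le hV.1 hc.le hdecay (hz t ht) h0 le_rfl ht le_rfl
      (fun τ hτ => hG τ hτ.1.le) hδ.le (fun τ hτ => hfar τ hτ.1.le)
    have h1 := hV.lyapunov_nonneg (z t).1 (gain_nonneg (hz t ht) h0 ⟨ht, le_rfl⟩)
    have h2 : c * δ ^ 2 * t = E₀ + 1 := by
      simp only [t]; field_simp
    rw [sub_zero] at key
    linarith
  refine ⟨s, fun t hst => ?_⟩
  rw [dist_zero_right]
  exact (hstab t z (hz t (hs.trans hst)) h0 s hs hsδ t ⟨hst, le_rfl⟩).1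

end Trajectories

end ControlData

end AdaptiveSafeguard

/-! ### The main theorem -/

theorem theorem2 {n p : ℕ} (S : AdaptiveSafeguard.ControlData n p)
    -- the system and the cost
    (hf : LocallyLipschitz S.f) (hf0 : S.f 0 = 0)
    (hg : ∀ i j, LocallyLipschitz fun x => S.g x i j)
    (hQ : S.Q.PosDef) (hR : S.R.PosDef)
    -- the solution of the HJB equation and the optimal policy
    (hV : S.IsHJBSolution) (hk : LocallyLipschitz S.kStar)
    -- the constraint function and the functions derived from it
    (hm : 1 ≤ S.m)
    (hα : ∀ i, 1 ≤ i → i < S.m → AdaptiveSafeguard.IsSmoothExtendedClassK (S.α i))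
    (hψ : ∀ i < S.m, ContDiff ℝ 1 (S.psi i))
    (hrel : ∀ i, i + 1 < S.m → ∀ x, 0 ≤ S.h x → S.lieG (S.psi i) x = 0)
    -- the origin is safe and the control dynamics are bounded above and below
    (h0 : 0 < S.h 0) (gLo gHi : ℝ) (hgLo : 0 < gLo) (hgHi : 0 < gHi)
    (hgb : ∀ x ∈ S.lastSet,
      gLo ≤ AdaptiveSafeguard.frobNorm (S.g x) ∧ AdaptiveSafeguard.frobNorm (S.g x) ≤ gHi)
    -- the energy function, the risk level and the parameters of the policy
    (hB : S.IsEnergyFunction) (W : ℝ) (hW : 0 < W)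
    (hμ : 0 ≤ S.μ ∧ S.μ ≤ 1) (hY : 0 < S.Y) (hKmax : 0 < S.Kmax)
    (hC : S.CondC1 W ∨ S.CondC2 W gHi) :
    AdaptiveSafeguard.OriginAsymptoticallyStable S.closedLoop S.stateSpace ∧
    ∀ z : ℝ → EuclideanSpace ℝ (Fin n) × ℝ,
      AdaptiveSafeguard.IsGlobalSolution S.closedLoop z → z 0 ∈ S.stateSpace →
      (∀ t, 0 ≤ t → (z t).1 ∈ S.riskSet W) →
      Tendsto z atTop (𝓝 0) := by

  have hpsi0 := AdaptiveSafeguard.ControlData.psi_zero_pos hf0 hα h0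
  have hlast0 : (0 : EuclideanSpace ℝ (Fin n)) ∈ S.lastSet := hpsi0 _ (by omega)
  have hfrob : 0 < AdaptiveSafeguard.frobNorm (S.g 0) := hgLo.trans_le (hgb 0 hlast0).1
  -- An empty matrix has Frobenius norm zero, so the lower bound on `g` at the origin excludes `n =
  -- 0` and `p = 0`.
  have : Nonempty (Fin n) := by
    by_contra h
    rw [not_nonempty_iff] at h
    simp [AdaptiveSafeguard.frobNorm] at hfrob
  have : Nonempty (Fin p) := by
    by_contra h
    rw [not_nonempty_iff] at h
    simp [AdaptiveSafeguard.frobNorm] at hfrob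
  obtain ⟨c, hc, hdec⟩ := AdaptiveSafeguard.ControlData.exists_decay_rate hQ hR hV
    (fun x hx => (hgb x hx).2) hμ.2 hY hC
  have hψm : ContDiff ℝ 1 (S.psi (S.m - 1)) := hψ _ (by omega)
  have hdecay : ∀ x ∈ S.riskSet W ∩ {x | 0 ≤ S.h x}, ∀ K, 0 ≤ K →
      inner ℝ (gradient S.V x) (S.nominal x (S.kStar x + S.uSafe x K)) + S.gainRate x K ≤
        -(c * (‖x‖ ^ 2 + K ^ 2)) := fun x hx K hK => hdec x hx.1 hx.2 K hK
  have hG : S.riskSet W ∩ {x | 0 ≤ S.h x} ∈ 𝓝 (0 : EuclideanSpace ℝ (Fin n)) := by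
    refine inter_mem (AdaptiveSafeguard.ControlData.riskSet_mem_nhds_zero hψm hlast0 hB hW) ?_
    have hcont : Continuous S.h := (hψ 0 (by omega)).continuous
    exact mem_of_superset ((isOpen_lt continuous_const hcont).mem_nhds h0)
      fun x (hx : 0 < S.h x) => hx.le
  refine ⟨⟨⟨⟨hpsi0, le_rfl, hKmax.le⟩,
    AdaptiveSafeguard.ControlData.closedLoop_zero hf0 hV⟩, fun ε hε => ?_, ?_⟩, ?_⟩
  · obtain ⟨δ, hδ, hstab⟩ :=
      AdaptiveSafeguard.ControlData.exists_stability_radius hV hG hc.le hdecay hε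
    exact ⟨δ, hδ, fun T z hz hz0 hzδ t ht => (hstab T z hz hz0.2.1 0 le_rfl hzδ t ht).1⟩
  -- The radius `1` is immaterial: stability is used here only to keep the trajectory in the decay
  -- region.
  · obtain ⟨δ, hδ, hstab⟩ :=
      AdaptiveSafeguard.ControlData.exists_stability_radius hV hG hc.le hdecay one_pos
    exact ⟨δ, hδ, fun z hz hz0 hzδ =>
      AdaptiveSafeguard.ControlData.tendsto_zero_of_forall_mem hV hG hc hdecay hz hz0.2.1
        fun t ht => (hstab t z (hz t ht) hz0.2.1 0 le_rfl hzδ t ⟨ht, le_rfl⟩).2⟩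
  · intro z hz hz0 hrisk
    refine AdaptiveSafeguard.ControlData.tendsto_zero_of_forall_mem hV hG hc hdecay hz hz0.2.1
      fun t ht => ⟨hrisk t ht, ?_⟩
    exact (AdaptiveSafeguard.ControlData.mem_safeCore (hz t ht) hα hψ hrel hz0.1
      (fun s hs => (hrisk s hs.1).1) ⟨ht, le_rfl⟩ 0 (by omega)).le
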